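/- Let $E=(E^0,E^1,r,s)$ be an arbitrary directed graph and $K$ an arbitrary field. Let $L=L_K(E)$ be the Leavitt path algebra of $E$ over $K$: the (not necessarily unital) associative $K$-algebra generated by $E^0\cup E^1\cup\{e^*: e\in E^1\}$ subject to the relations - $vv'=\delta_{v,v'}v$ for $v,v'\in E^0$, - $s(e)e=e\,r(e)=e$ and $r(e)e^*=e^*s(e)=e^*$ for $e\in E^1$, - $e^*f=\delta_{e,f}\,r(e)$ for $e,f\in E^1$, - $v=\sum_{s(e)=v}ee^*$ for every vertex $v$ that emits at least one and only finitely many edges. Let $x\mapsto x^*$ be the standard involution of $L$, i.e. the $K$-linear anti-automorphism that fixes every vertex and exchanges $e$ and $e^*$ for every edge $e$. Put $\mathbf K_L=\{x\in L: x^*=-x\}$, and for a $K$-subspace $I$ of $L$ let $[I,I]$ be the $K$-subspace spanned by all $ab-ba$ with $a,b\in I$. A cycle is a path $c=e_1\cdots e_n$ with $n\ge 1$, $r(e_i)=s(e_{i+1})$ for $1\le i<n$, $r(e_n)=s(e_1)$, and $s(e_i)\neq s(e_j)$ for $i\ne j$. If $E$ contains a cycle, then $$\mathbf K_L\neq[\mathbf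 K_L,\mathbf K_L].$$ Moreover, for every cycle $c$ in $E$ one has $c-c^*\in\mathbf K_L$ and $c-c^*\notin[L,L]$. -/

import Mathlib

/-! A directed graph `E = (E⁰, E¹, r, s)` is a type `V` (the vertices) with a quiver structure: the
edges are `Quiver.Total V`, the source of an edge `e` is `e.left` and its range is `e.right`. There
is no finiteness assumption. Paths (including those of length `0`) are `Quiver.Path`. -/

/-- The generating set `E⁰ ∪ E¹ ∪ (E¹)*` (a disjoint union). -/
inductive LeavittGen (V : Type*) [Quiver V] where
  | vertex (v : V) : LeavittGen V
  | edge (e : Quiver.Total V) : LeavittGen V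
  | ghost (e : Quiver.Total V) : LeavittGen V

/-- The bijection of the generating set that fixes every vertex and exchanges `e` and `e*`. -/
def LeavittGen.swap {V : Type*} [Quiver V] : LeavittGen V → LeavittGen V
  | .vertex v => .vertex v
  | .edge e => .ghost e
  | .ghost e => .edge e

/-- The free associative (not necessarily unital) `K`-algebra on `E⁰ ∪ E¹ ∪ (E¹)*`: its `K`-basis
consists of the nonempty words in the generators, multiplied by concatenation. -/
abbrev LeavittFree (K : Type*) [Field K] (V : Type*) [Quiver V] : Type _ :=
  MonoidAlgebra K (FreeSemigroup (LeavittGen V))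

namespace LeavittFree

variable (K : Type*) [Field K] {V : Type*} [Quiver V]

/-- A generator, as an element of the free algebra. -/
noncomputable def of (x : LeavittGen V) : LeavittFree K V :=
  MonoidAlgebra.single (FreeSemigroup.of x) 1

/-- The defining relations of the Leavitt path algebra; `Rel K x y` stands for the relation
`x = y`. Relations with a Kronecker delta are split into the two cases. -/
inductive Rel : LeavittFree K V → LeavittFree K V → Prop
  /-- (V), for equal vertices -/
  | vertex_self (v : V) : Rel (of K (.vertex v) * of K (.vertex v)) (of K (.vertex v))
  /-- (V), for different vertices -/
  | vertex_ne (v w : V) (h : v ≠ w) : Rel (of K (.vertex v) * of K (.vertex w)) 0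
  /-- (E1) -/
  | source_edge (e : Quiver.Total V) : Rel (of K (.vertex e.left) * of K (.edge e)) (of K (.edge e))
  /-- (E1) -/
  | edge_range (e : Quiver.Total V) : Rel (of K (.edge e) * of K (.vertex e.right)) (of K (.edge e))
  /-- (E2) -/
  | range_ghost (e : Quiver.Total V) :
      Rel (of K (.vertex e.right) * of K (.ghost e)) (of K (.ghost e))
  /-- (E2) -/
  | ghost_source (e : Quiver.Total V) :
      Rel (of K (.ghost e) * of K (.vertex e.left)) (of K (.ghost e))
  /-- (CK1), for equal edges -/
  | ck1_self (e : Quiver.Total V) :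
      Rel (of K (.ghost e) * of K (.edge e)) (of K (.vertex e.right))
  /-- (CK1), for different edges -/
  | ck1_ne (e f : Quiver.Total V) (h : e ≠ f) : Rel (of K (.ghost e) * of K (.edge f)) 0
  /-- (CK2), for a regular vertex `v`: the set `S` of all edges with source `v` is finite and
  nonempty. -/
  | ck2 (v : V) (S : Finset (Quiver.Total V)) (hS : ∀ e, e ∈ S ↔ e.left = v) (hne : S.Nonempty) :
      Rel (of K (.vertex v)) (∑ e ∈ S, of K (.edge e) * of K (.ghost e))

variable (V)

/-- The two-sided ideal of the free algebra generated by the defining relations: the smallest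
`K`-subspace that contains `x - y` for every relation `x = y` and is closed under multiplication by
arbitrary elements of the free algebra on either side. -/
noncomputable def relIdeal : Submodule K (LeavittFree K V) :=
  sInf {J | (∀ x y, Rel K x y → x - y ∈ J) ∧ ∀ a, ∀ x ∈ J, a * x ∈ J ∧ x * a ∈ J}

variable {V}

theorem sub_mem_relIdeal {x y : LeavittFree K V} (h : Rel K x y) : x - y ∈ relIdeal K V :=
  Submodule.mem_sInf.2 fun _ hJ => hJ.1 x y h

theorem mul_mem_relIdeal_left (a : LeavittFree K V) {x : LeavittFree K V}
    (hx : x ∈ relIdeal K V) : a * x ∈ relIdeal K V :=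
  Submodule.mem_sInf.2 fun J hJ => (hJ.2 a x (Submodule.mem_sInf.1 hx J hJ)).1

theorem mul_mem_relIdeal_right (a : LeavittFree K V) {x : LeavittFree K V}
    (hx : x ∈ relIdeal K V) : x * a ∈ relIdeal K V :=
  Submodule.mem_sInf.2 fun J hJ => (hJ.2 a x (Submodule.mem_sInf.1 hx J hJ)).2

theorem relIdeal_le {J : Submodule K (LeavittFree K V)} (h₁ : ∀ x y, Rel K x y → x - y ∈ J)
    (h₂ : ∀ a, ∀ x ∈ J, a * x ∈ J ∧ x * a ∈ J) : relIdeal K V ≤ J :=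
  sInf_le ⟨h₁, h₂⟩

variable (V)

/-- The anti-endomorphism of the free algebra that fixes the scalars and the vertices and exchanges
`e` and `e*`, written as a homomorphism to the opposite algebra. -/
noncomputable def starHom : LeavittFree K V →ₙₐ[K] (LeavittFree K V)ᵐᵒᵖ :=
  MonoidAlgebra.liftMagma K (FreeSemigroup.lift fun x => MulOpposite.op (of K x.swap))

/-- The same map as a `K`-linear map from the free algebra to itself. -/
noncomputable def starLin : LeavittFree K V →ₗ[K] LeavittFree K V :=
  (MulOpposite.opLinearEquiv K).symm.toLinearMap ∘ₗ (starHom K V : LeavittFree K V →ₗ[K] _)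

variable {V}

theorem starLin_of (x : LeavittGen V) : starLin K V (of K x) = of K x.swap := by
  simp [starLin, starHom, of, MonoidAlgebra.liftMagma_apply_apply]

theorem starLin_mul (a b : LeavittFree K V) :
    starLin K V (a * b) = starLin K V b * starLin K V a := by
  simp [starLin]

theorem starLin_starLin (a : LeavittFree K V) : starLin K V (starLin K V a) = a := by
  have h : ∀ w : FreeSemigroup (LeavittGen V),
      starLin K V (starLin K V (MonoidAlgebra.single w 1)) = MonoidAlgebra.single w 1 := by
    intro w
    induction w using FreeSemigroup.recOnMul with
    | ih1 x =>
      change starLin K V (starLin K V (of K x)) = of K x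
      rw [starLin_of, starLin_of]
      cases x <;> rfl
    | ih2 x y hx hy =>
      have : (MonoidAlgebra.single (FreeSemigroup.of x * y) 1 : LeavittFree K V) =
          MonoidAlgebra.single (FreeSemigroup.of x) 1 * MonoidAlgebra.single y 1 := by
        simp [MonoidAlgebra.single_mul_single]
      rw [this, starLin_mul, starLin_mul, hx, hy]
  have h2 : (starLin K V) ∘ₗ (starLin K V) = LinearMap.id := by
    ext w
    simp [h w]
  exact LinearMap.congr_fun h2 a

theorem starLin_mem_relIdeal {x : LeavittFree K V} (hx : x ∈ relIdeal K V) :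
    starLin K V x ∈ relIdeal K V := by
  suffices relIdeal K V ≤ (relIdeal K V).comap (starLin K V) from this hx
  refine relIdeal_le K ?_ ?_
  · intro x y h
    rw [Submodule.mem_comap, map_sub]
    apply sub_mem_relIdeal
    cases h with
    | vertex_self v => simpa [starLin_mul, starLin_of, LeavittGen.swap] using Rel.vertex_self v
    | vertex_ne v w h =>
      simpa [starLin_mul, starLin_of, LeavittGen.swap] using Rel.vertex_ne w v h.symm
    | source_edge e => simpa [starLin_mul, starLin_of, LeavittGen.swap] using Rel.ghost_source e
    | edge_range e => simpa [starLin_mul, starLin_of, LeavittGen.swap] using Rel.range_ghost e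
    | range_ghost e => simpa [starLin_mul, starLin_of, LeavittGen.swap] using Rel.edge_range e
    | ghost_source e => simpa [starLin_mul, starLin_of, LeavittGen.swap] using Rel.source_edge e
    | ck1_self e => simpa [starLin_mul, starLin_of, LeavittGen.swap] using Rel.ck1_self e
    | ck1_ne e f h => simpa [starLin_mul, starLin_of, LeavittGen.swap] using Rel.ck1_ne f e h.symm
    | ck2 v S hS hne => simpa [starLin_mul, starLin_of, LeavittGen.swap] using Rel.ck2 v S hS hne
  · intro a x hx
    rw [Submodule.mem_comap] at hx
    simp only [Submodule.mem_comap, starLin_mul]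
    exact ⟨mul_mem_relIdeal_right K _ hx, mul_mem_relIdeal_left K _ hx⟩

end LeavittFree

/-- The Leavitt path algebra `L_K(E)`: the free associative algebra on `E⁰ ∪ E¹ ∪ (E¹)*` modulo the
ideal generated by the relations (V), (E1), (E2), (CK1) and (CK2). -/
def LeavittPathAlgebra (K : Type*) [Field K] (V : Type*) [Quiver V] : Type _ :=
  LeavittFree K V ⧸ LeavittFree.relIdeal K V

namespace LeavittPathAlgebra

variable (K : Type*) [Field K] (V : Type*) [Quiver V]

noncomputable instance : AddCommGroup (LeavittPathAlgebra K V) :=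
  inferInstanceAs (AddCommGroup (LeavittFree K V ⧸ LeavittFree.relIdeal K V))

noncomputable instance : Module K (LeavittPathAlgebra K V) :=
  inferInstanceAs (Module K (LeavittFree K V ⧸ LeavittFree.relIdeal K V))

/-- The quotient map from the free algebra. -/
noncomputable def mk : LeavittFree K V →ₗ[K] LeavittPathAlgebra K V :=
  (LeavittFree.relIdeal K V).mkQ

variable {K V}

theorem mk_surjective : Function.Surjective (mk K V) :=
  Submodule.mkQ_surjective _

theorem mk_eq_mk {a b : LeavittFree K V} : mk K V a = mk K V b ↔ a - b ∈ LeavittFree.relIdeal K V :=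
  Submodule.Quotient.eq _

/-- The product induced by that of the free algebra. -/
noncomputable instance : Mul (LeavittPathAlgebra K V) where
  mul := Quotient.map₂ (· * ·) fun a a' ha b b' hb => by
    have ha' : a - a' ∈ LeavittFree.relIdeal K V := (Submodule.quotientRel_def _).1 ha
    have hb' : b - b' ∈ LeavittFree.relIdeal K V := (Submodule.quotientRel_def _).1 hb
    refine (Submodule.quotientRel_def _).2 ?_
    have h := add_mem (LeavittFree.mul_mem_relIdeal_right K b ha')
      (LeavittFree.mul_mem_relIdeal_left K a' hb')
    simpa [sub_mul, mul_sub] using h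

theorem mk_mul (a b : LeavittFree K V) : mk K V (a * b) = mk K V a * mk K V b :=
  rfl

noncomputable instance : NonUnitalRing (LeavittPathAlgebra K V) where
  left_distrib a b c := by
    obtain ⟨a, rfl⟩ := mk_surjective a
    obtain ⟨b, rfl⟩ := mk_surjective b
    obtain ⟨c, rfl⟩ := mk_surjective c
    rw [← map_add, ← mk_mul, ← mk_mul, ← mk_mul, ← map_add, mul_add]
  right_distrib a b c := by
    obtain ⟨a, rfl⟩ := mk_surjective a
    obtain ⟨b, rfl⟩ := mk_surjective b
    obtain ⟨c, rfl⟩ := mk_surjective c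
    rw [← map_add, ← mk_mul, ← mk_mul, ← mk_mul, ← map_add, add_mul]
  zero_mul a := by
    obtain ⟨a, rfl⟩ := mk_surjective a
    rw [← map_zero (mk K V), ← mk_mul, zero_mul]
  mul_zero a := by
    obtain ⟨a, rfl⟩ := mk_surjective a
    rw [← map_zero (mk K V), ← mk_mul, mul_zero]
  mul_assoc a b c := by
    obtain ⟨a, rfl⟩ := mk_surjective a
    obtain ⟨b, rfl⟩ := mk_surjective b
    obtain ⟨c, rfl⟩ := mk_surjective c
    rw [← mk_mul, ← mk_mul, ← mk_mul, ← mk_mul, mul_assoc]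

instance : IsScalarTower K (LeavittPathAlgebra K V) (LeavittPathAlgebra K V) where
  smul_assoc k a b := by
    obtain ⟨a, rfl⟩ := mk_surjective a
    obtain ⟨b, rfl⟩ := mk_surjective b
    rw [smul_eq_mul, smul_eq_mul, ← map_smul, ← mk_mul, ← mk_mul, ← map_smul, smul_mul_assoc]

instance : SMulCommClass K (LeavittPathAlgebra K V) (LeavittPathAlgebra K V) where
  smul_comm k a b := by
    obtain ⟨a, rfl⟩ := mk_surjective a
    obtain ⟨b, rfl⟩ := mk_surjective b
    rw [smul_eq_mul, smul_eq_mul, ← map_smul, ← mk_mul, ← mk_mul, ← map_smul, mul_smul_comm]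

variable (K V)

/-- The standard involution as a `K`-linear map: it fixes the vertices and exchanges `e` and
`e*`. -/
noncomputable def starLin : LeavittPathAlgebra K V →ₗ[K] LeavittPathAlgebra K V :=
  (LeavittFree.relIdeal K V).mapQ (LeavittFree.relIdeal K V) (LeavittFree.starLin K V)
    fun _ hx => LeavittFree.starLin_mem_relIdeal K hx

variable {K V}

theorem starLin_mk (a : LeavittFree K V) :
    starLin K V (mk K V a) = mk K V (LeavittFree.starLin K V a) :=
  rfl

/-- The standard involution `x ↦ x*`. -/
noncomputable instance : StarRing (LeavittPathAlgebra K V) where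
  star := starLin K V
  star_involutive a := by
    obtain ⟨a, rfl⟩ := mk_surjective a
    change starLin K V (starLin K V _) = _
    rw [starLin_mk, starLin_mk, LeavittFree.starLin_starLin]
  star_mul a b := by
    obtain ⟨a, rfl⟩ := mk_surjective a
    obtain ⟨b, rfl⟩ := mk_surjective b
    change starLin K V _ = starLin K V _ * starLin K V _
    rw [← mk_mul, starLin_mk, starLin_mk, starLin_mk, LeavittFree.starLin_mul, mk_mul]
  star_add a b := map_add (starLin K V) a b

theorem star_smul' (k : K) (a : LeavittPathAlgebra K V) : star (k • a) = k • star a :=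
  map_smul (starLin K V) k a

variable (K)

/-- A vertex, as an element of `L_K(E)`. -/
noncomputable def vertex (v : V) : LeavittPathAlgebra K V :=
  mk K V (LeavittFree.of K (.vertex v))

/-- An edge, as an element of `L_K(E)`. -/
noncomputable def edge (e : Quiver.Total V) : LeavittPathAlgebra K V :=
  mk K V (LeavittFree.of K (.edge e))

/-- The element `e*` of `L_K(E)`, for an edge `e`. -/
noncomputable def ghost (e : Quiver.Total V) : LeavittPathAlgebra K V :=
  mk K V (LeavittFree.of K (.ghost e))

theorem star_vertex (v : V) : star (vertex K v) = vertex K v :=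
  congrArg (mk K V) (LeavittFree.starLin_of K _)

theorem star_edge (e : Quiver.Total V) : star (edge K e) = ghost K e :=
  congrArg (mk K V) (LeavittFree.starLin_of K _)

theorem star_ghost (e : Quiver.Total V) : star (ghost K e) = edge K e :=
  congrArg (mk K V) (LeavittFree.starLin_of K _)

/-- A path `e₁ ⋯ eₙ` from `v` to `w`, as the element `v e₁ ⋯ eₙ` of `L_K(E)`. (This is `v` if `n = 0`
and equals `e₁ ⋯ eₙ` if `n ≥ 1`.) -/
noncomputable def ofPath {v : V} : ∀ {w : V}, Quiver.Path v w → LeavittPathAlgebra K V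
  | _, .nil => vertex K v
  | _, .cons p e => ofPath p * edge K ⟨_, _, e⟩

variable (V)

/-- The subspace of skew-symmetric elements with respect to the standard involution. -/
def skewSymmetric : Submodule K (LeavittPathAlgebra K V) where
  carrier := {x | star x = -x}
  add_mem' {a b} ha hb := by
    simp only [Set.mem_ofPred_eq] at *
    rw [star_add, ha, hb, neg_add]
  zero_mem' := by simp
  smul_mem' k a ha := by
    simp only [Set.mem_ofPred_eq] at *
    rw [star_smul', ha, smul_neg]

end LeavittPathAlgebra

/-- For a `K`-subspace `I` of an associative `K`-algebra, the `K`-subspace `[I, I]` spanned by the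
commutators `ab - ba` with `a, b ∈ I`. -/
def commutatorSpan {K : Type*} [Field K] {A : Type*} [NonUnitalRing A] [Module K A]
    (I : Submodule K A) : Submodule K A :=
  Submodule.span K {z | ∃ a ∈ I, ∃ b ∈ I, z = a * b - b * a}

/-- A closed path `e₁ ⋯ eₙ` based at `v` is a cycle based at `v` if `n ≥ 1` and the sources
`s(e₁), …, s(eₙ)` are pairwise different. These sources are all the entries but the last one of the
list `s(e₁), …, s(eₙ), r(eₙ)` of vertices of the path. -/
def Quiver.Path.IsCycleAt {V : Type*} [Quiver V] {v : V} (c : Quiver.Path v v) : Prop :=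
  1 ≤ c.length ∧ c.vertices.dropLast.Nodup

/-!
The proof constructs a trace on the Leavitt path algebra `L`, that is, a linear functional that
vanishes on `[L, L]`, which takes the value `1` at `c - c*`.

The generators act on infinite paths by partial injections: a vertex `v` is the identity on the paths
starting at `v`, an edge `e` takes `z` to `e z` if `z` starts at the range of `e`, and `e*` is the
inverse of `e`. For `n > 0`, let `T` be the functional on the free algebra that takes a word of degree
`n` (for the `ℤ`-grading in which edges have degree `1` and ghost edges degree `-1`) to its number of
fixed points, and all other words to `0`. The words `u w` and `w u` have equally many fixed points,
since `w` maps those of the one to those of the other; hence `T (a b) = T (b a)`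
(`LeavittFree.trace_mul_comm`).

The relations other than (CK2) are equalities of partial injections of the same degree. For (CK2),
the fixed points of `v w` are partitioned by their first edges `e`, and the parts are the sets of
fixed points of `e e* w`; so only finiteness is needed. In fact a word of positive degree has at most
one fixed point (`InfinitePath.wordRel_self_unique`), so that `T` can be given the values `0` and `1`.
Since `T` is a trace, it therefore kills the ideal of relations
(`LeavittFree.trace_eq_zero_of_mem_relIdeal`) and descends to `L`.

If `c` is a closed path of length `n > 0`, then `c c c ⋯` is a fixed point of `c`, so `T c = 1`
(`LeavittPathAlgebra.trace_ofPath`), while `T c* = 0` as `c*` has degree `-n ≠ n`. That the vertices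
of `c` are distinct plays no role.
-/

/-! ### Words in the generators acting on infinite paths -/

namespace LeavittGen

variable {V : Type*} [Quiver V]

/-- The degree of a generator for the standard `ℤ`-grading. -/
def degree : LeavittGen V → ℤ
  | .vertex _ => 0
  | .edge _ => 1
  | .ghost _ => -1

end LeavittGen

/-- An infinite path `e₀ e₁ e₂ ⋯` in a directed graph. -/
@[ext]
structure InfinitePath (V : Type*) [Quiver V] where
  /-- The edges of the path. -/
  edge : ℕ → Quiver.Total V
  /-- Consecutive edges fit together. -/
  right_eq_left : ∀ i, (edge i).right = (edge (i + 1)).left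

namespace InfinitePath

variable {V : Type*} [Quiver V]

/-- The path without its first `n` edges. -/
def drop (z : InfinitePath V) (n : ℕ) : InfinitePath V where
  edge i := z.edge (n + i)
  right_eq_left i := z.right_eq_left (n + i)

/-- The path with a further edge in front. -/
def cons (e : Quiver.Total V) (z : InfinitePath V) (h : e.right = (z.edge 0).left) :
    InfinitePath V where
  edge
    | 0 => e
    | i + 1 => z.edge i
  right_eq_left
    | 0 => h
    | i + 1 => z.right_eq_left i

/-- `Extends e z z'` says that `z = e z'`. -/
def Extends (e : Quiver.Total V) (z z' : InfinitePath V) : Prop :=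
  z.edge 0 = e ∧ ∀ i, z.edge (i + 1) = z'.edge i

theorem Extends.right_eq {e : Quiver.Total V} {z z' : InfinitePath V} (h : Extends e z z') :
    e.right = (z'.edge 0).left := by
  rw [← h.1, z.right_eq_left, h.2]

theorem Extends.left_unique {e : Quiver.Total V} {z₁ z₂ z' : InfinitePath V}
    (h₁ : Extends e z₁ z') (h₂ : Extends e z₂ z') : z₁ = z₂ := by
  ext1
  funext i
  cases i with
  | zero => rw [h₁.1, h₂.1]
  | succ i => rw [h₁.2, h₂.2]

theorem Extends.right_unique {e f : Quiver.Total V} {z z₁ z₂ : InfinitePath V}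
    (h₁ : Extends e z z₁) (h₂ : Extends f z z₂) : z₁ = z₂ := by
  ext1
  funext i
  rw [← h₁.2, h₂.2]

theorem extends_cons {e : Quiver.Total V} {z : InfinitePath V}
    (h : e.right = (z.edge 0).left) : Extends e (cons e z h) z :=
  ⟨rfl, fun _ => rfl⟩

theorem extends_drop_one (z : InfinitePath V) : Extends (z.edge 0) z (z.drop 1) :=
  ⟨rfl, fun i => congrArg z.edge (add_comm i 1)⟩

/-- The partial injection by which a generator acts on infinite paths, as a relation: `GenRel x z z'`
says that `x z' = z`. A vertex is the identity on the paths starting there, an edge is put in front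
of a path, and a ghost edge removes the corresponding first edge. -/
def GenRel : LeavittGen V → InfinitePath V → InfinitePath V → Prop
  | .vertex v, z, z' => z = z' ∧ (z.edge 0).left = v
  | .edge e, z, z' => Extends e z z'
  | .ghost e, z, z' => Extends e z' z

/-- The action of a word in the generators on infinite paths, as a relation. -/
def WordRel : List (LeavittGen V) → InfinitePath V → InfinitePath V → Prop
  | [], z, z' => z = z'
  | x :: l, z, z' => ∃ y, GenRel x z y ∧ WordRel l y z'

theorem wordRel_append (l₁ l₂ : List (LeavittGen V)) (z z' : InfinitePath V) :
    WordRel (l₁ ++ l₂) z z' ↔ ∃ y, WordRel l₁ z y ∧ WordRel l₂ y z' := by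
  induction l₁ generalizing z with
  | nil => simp [WordRel]
  | cons x l ih =>
    simp only [List.cons_append, WordRel, ih]
    constructor
    · rintro ⟨y, hy, u, hu, hu'⟩
      exact ⟨u, ⟨y, hy, hu⟩, hu'⟩
    · rintro ⟨u, ⟨y, hy, hu⟩, hu'⟩
      exact ⟨y, hy, u, hu, hu'⟩

/-- The degree of a word for the standard `ℤ`-grading. -/
def wordDegree (l : List (LeavittGen V)) : ℤ :=
  (l.map LeavittGen.degree).sum

theorem wordDegree_append (l₁ l₂ : List (LeavittGen V)) :
    wordDegree (l₁ ++ l₂) = wordDegree l₁ + wordDegree l₂ := by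
  simp [wordDegree]

/-- A word acts like some `p q*`, where `p` consists of the first `a` entries of a sequence and `q`
has length `b`: it sends `q y` to `p y`. -/
theorem exists_wordRel_prefix [Nonempty (Quiver.Total V)] (l : List (LeavittGen V)) :
    ∃ (a b : ℕ) (p : ℕ → Quiver.Total V), (a : ℤ) - b = wordDegree l ∧
      ∀ z z', WordRel l z z' →
        (∀ i < a, z.edge i = p i) ∧ ∀ i, z.edge (a + i) = z'.edge (b + i) := by
  induction l with
  | nil =>
    refine ⟨0, 0, fun _ => Classical.arbitrary _, by simp [wordDegree], ?_⟩
    rintro z _ rfl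
    simp
  | cons x l ih =>
    obtain ⟨a, b, p, hab, h⟩ := ih
    have hdeg : wordDegree (x :: l) = x.degree + wordDegree l := by simp [wordDegree]
    rw [hdeg, ← hab]
    cases x with
    | vertex v =>
      refine ⟨a, b, p, by simp [LeavittGen.degree], ?_⟩
      rintro z z' ⟨y, ⟨rfl, -⟩, hy⟩
      exact h z z' hy
    | edge e =>
      refine ⟨a + 1, b, fun i => i.casesOn e p, by simp [LeavittGen.degree]; ring, ?_⟩
      rintro z z' ⟨y, ⟨h0, hs⟩, hy⟩
      obtain ⟨h1, h2⟩ := h y z' hy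
      refine ⟨fun i hi => ?_, fun i => ?_⟩
      · cases i with
        | zero => exact h0
        | succ i => exact (hs i).trans (h1 i (by omega))
      · rw [← h2 i, ← hs, add_right_comm]
    | ghost e =>
      cases a with
      | zero =>
        refine ⟨0, b + 1, p, by simp [LeavittGen.degree], ?_⟩
        rintro z z' ⟨y, ⟨h0, hs⟩, hy⟩
        obtain ⟨-, h2⟩ := h y z' hy
        refine ⟨fun i hi => absurd hi (Nat.not_lt_zero i), fun i => ?_⟩
        rw [zero_add, ← hs, add_assoc, add_comm 1 i, ← h2, zero_add]
      | succ a =>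
        refine ⟨a, b, fun i => p (i + 1), by simp [LeavittGen.degree]; ring, ?_⟩
        rintro z z' ⟨y, ⟨h0, hs⟩, hy⟩
        obtain ⟨h1, h2⟩ := h y z' hy
        refine ⟨fun i hi => ?_, fun i => ?_⟩
        · rw [← hs, h1 (i + 1) (by omega)]
        · rw [← h2 i, ← hs, add_right_comm]

/-- A word of positive degree has at most one fixed point: if it acts like `p q*`, then `p = q d`
with `d` closed, and the fixed point is `q d d d ⋯`. -/
theorem wordRel_self_unique {l : List (LeavittGen V)} (hl : 0 < wordDegree l)
    {z z' : InfinitePath V} (hz : WordRel l z z) (hz' : WordRel l z' z') : z = z' := by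
  have : Nonempty (Quiver.Total V) := ⟨z.edge 0⟩
  obtain ⟨a, b, p, hab, h⟩ := exists_wordRel_prefix l
  obtain ⟨h1, h2⟩ := h z z hz
  obtain ⟨h1', h2'⟩ := h z' z' hz'
  ext1
  funext i
  induction i using Nat.strong_induction_on with
  | _ i ih =>
    rcases lt_or_ge i a with hi | hi
    · rw [h1 i hi, h1' i hi]
    · obtain ⟨j, rfl⟩ := Nat.exists_eq_add_of_le hi
      rw [h2, h2']
      exact ih _ (by omega)

end InfinitePath

/-! ### The trace on the free algebra -/

namespace LeavittFree

open InfinitePath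

variable (K : Type*) [Field K] {V : Type*} [Quiver V]

open Classical in
/-- The value of the trace functional of degree `n` on a word: `1` if the word has degree `n` and a
fixed point on infinite paths, and `0` otherwise. For `n > 0` this is the number of fixed points of a
word of degree `n`. -/
noncomputable def wordTrace (n : ℕ) (l : List (LeavittGen V)) : K :=
  if wordDegree l = n ∧ ∃ z, WordRel l z z then 1 else 0

open Classical in
variable {K} in
theorem wordTrace_congr_iff {n : ℕ} {l₁ l₂ : List (LeavittGen V)}
    (hd : wordDegree l₁ = wordDegree l₂)
    (h : (∃ z, WordRel l₁ z z) ↔ ∃ z, WordRel l₂ z z) : wordTrace K n l₁ = wordTrace K n l₂ :=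
  if_congr (by rw [hd, h]) rfl rfl

theorem wordTrace_append_comm (n : ℕ) (l₁ l₂ : List (LeavittGen V)) :
    wordTrace K n (l₁ ++ l₂) = wordTrace K n (l₂ ++ l₁) := by
  refine wordTrace_congr_iff (by simp only [wordDegree_append, add_comm]) ?_
  simp only [wordRel_append]
  constructor <;> exact fun ⟨z, y, h, h'⟩ => ⟨y, z, h', h⟩

theorem wordTrace_congr (n : ℕ) {l₁ l₂ : List (LeavittGen V)}
    (hd : wordDegree l₁ = wordDegree l₂) (h : ∀ z z', WordRel l₁ z z' ↔ WordRel l₂ z z')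
    (l : List (LeavittGen V)) : wordTrace K n (l₁ ++ l) = wordTrace K n (l₂ ++ l) :=
  wordTrace_congr_iff (by simp only [wordDegree_append, hd]) (by simp only [wordRel_append, h])

theorem wordTrace_eq_zero (n : ℕ) {l₁ : List (LeavittGen V)}
    (h : ∀ z z', ¬ WordRel l₁ z z') (l : List (LeavittGen V)) : wordTrace K n (l₁ ++ l) = 0 :=
  if_neg fun ⟨_, z, hz⟩ => by
    obtain ⟨y, hy, -⟩ := (wordRel_append l₁ l z z).1 hz
    exact h z y hy

theorem wordRel_vertex (v : V) (z z' : InfinitePath V) :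
    WordRel [.vertex v] z z' ↔ z = z' ∧ (z.edge 0).left = v := by
  simp only [WordRel, GenRel]
  constructor
  · rintro ⟨y, ⟨rfl, h⟩, rfl⟩
    exact ⟨rfl, h⟩
  · rintro ⟨rfl, h⟩
    exact ⟨z, ⟨rfl, h⟩, rfl⟩

theorem wordRel_edge_ghost (e : Quiver.Total V) (z z' : InfinitePath V) :
    WordRel [.edge e, .ghost e] z z' ↔ z = z' ∧ z.edge 0 = e := by
  simp only [WordRel, GenRel]
  constructor
  · rintro ⟨y, h, y', h', rfl⟩
    exact ⟨h.left_unique h', h.1⟩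
  · rintro ⟨rfl, rfl⟩
    exact ⟨_, z.extends_drop_one, _, z.extends_drop_one, rfl⟩

theorem wordRel_ghost_edge (e : Quiver.Total V) (z z' : InfinitePath V) :
    WordRel [.ghost e, .edge e] z z' ↔ WordRel [.vertex e.right] z z' := by
  rw [wordRel_vertex]
  simp only [WordRel, GenRel]
  constructor
  · rintro ⟨y, h, y', h', rfl⟩
    exact ⟨h.right_unique h', h.right_eq.symm⟩
  · rintro ⟨rfl, h⟩
    exact ⟨_, extends_cons h.symm, _, extends_cons h.symm, rfl⟩

/-- The uniqueness of the fixed point turns the decomposition of the paths from `v` by their first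
edge into an equation between `0`-`1`-valued traces. -/
theorem wordTrace_vertex {n : ℕ} (hn : 0 < n) (v : V) (S : Finset (Quiver.Total V))
    (hS : ∀ e, e ∈ S ↔ e.left = v) (l : List (LeavittGen V)) :
    wordTrace K n ([.vertex v] ++ l) =
      ∑ e ∈ S, wordTrace K n ([.edge e, .ghost e] ++ l) := by
  have hv (w : V) : wordDegree ([.vertex w] ++ l) = wordDegree l := by
    simp [wordDegree, LeavittGen.degree]
  have he (e : Quiver.Total V) : wordDegree ([.edge e, .ghost e] ++ l) = wordDegree l := by
    simp [wordDegree, LeavittGen.degree]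
  have hv' : (∃ z, WordRel ([.vertex v] ++ l) z z) ↔
      ∃ z, WordRel l z z ∧ (z.edge 0).left = v := by
    simp only [wordRel_append, wordRel_vertex]
    exact ⟨fun ⟨z, _, ⟨h, hz⟩, h'⟩ => ⟨z, h ▸ h', hz⟩, fun ⟨z, h, hz⟩ => ⟨z, z, ⟨rfl, hz⟩, h⟩⟩
  have he' (e : Quiver.Total V) : (∃ z, WordRel ([.edge e, .ghost e] ++ l) z z) ↔
      ∃ z, WordRel l z z ∧ z.edge 0 = e := by
    simp only [wordRel_append, wordRel_edge_ghost]
    exact ⟨fun ⟨z, _, ⟨h, hz⟩, h'⟩ => ⟨z, h ▸ h', hz⟩, fun ⟨z, h, hz⟩ => ⟨z, z, ⟨rfl, hz⟩, h⟩⟩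
  unfold wordTrace
  by_cases hd : wordDegree l = n
  swap
  · rw [if_neg fun h => hd ((hv v).symm.trans h.1), Finset.sum_eq_zero]
    exact fun e _ => if_neg fun h => hd ((he e).symm.trans h.1)
  have hl : 0 < wordDegree l := by omega
  by_cases hz : ∃ z, WordRel l z z ∧ (z.edge 0).left = v
  · rw [if_pos ⟨(hv v).trans hd, hv'.2 hz⟩]
    obtain ⟨z, hz, hzv⟩ := hz
    rw [Finset.sum_eq_single_of_mem _ ((hS _).2 hzv),
      if_pos ⟨(he _).trans hd, (he' _).2 ⟨z, hz, rfl⟩⟩]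
    refine fun e _ hne => if_neg fun h => hne ?_
    obtain ⟨y, hy, rfl⟩ := (he' e).1 h.2
    rw [wordRel_self_unique hl hy hz]
  · rw [if_neg fun h => hz (hv'.1 h.2), Finset.sum_eq_zero]
    refine fun e heS => if_neg fun h => hz ?_
    obtain ⟨y, hy, rfl⟩ := (he' e).1 h.2
    exact ⟨y, hy, (hS _).1 heS⟩

/-- The letters of a nonempty word. -/
def letters (w : FreeSemigroup (LeavittGen V)) : List (LeavittGen V) :=
  w.head :: w.tail

theorem letters_of (x : LeavittGen V) : letters (FreeSemigroup.of x) = [x] := rfl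

theorem letters_mul (w₁ w₂ : FreeSemigroup (LeavittGen V)) :
    letters (w₁ * w₂) = letters w₁ ++ letters w₂ := by
  simp [letters]

/-- The linear functional on the free algebra that takes a word `w` to the trace of `w l`. For the
empty word `l` this is the trace functional of degree `n`. -/
noncomputable def trace (n : ℕ) (l : List (LeavittGen V)) : LeavittFree K V →ₗ[K] K :=
  (Finsupp.linearCombination K fun w => wordTrace K n (letters w ++ l)) ∘ₗ
    (MonoidAlgebra.coeffLinearEquiv K).toLinearMap

theorem trace_single (n : ℕ) (l : List (LeavittGen V)) (w : FreeSemigroup (LeavittGen V)) :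
    trace K n l (MonoidAlgebra.single w 1) = wordTrace K n (letters w ++ l) := by
  simp [trace]

theorem trace_of (n : ℕ) (l : List (LeavittGen V)) (x : LeavittGen V) :
    trace K n l (of K x) = wordTrace K n ([x] ++ l) :=
  trace_single K n l _

theorem trace_of_mul_of (n : ℕ) (l : List (LeavittGen V)) (x y : LeavittGen V) :
    trace K n l (of K x * of K y) = wordTrace K n ([x, y] ++ l) := by
  rw [of, of, MonoidAlgebra.single_mul_single, one_mul, trace_single, letters_mul]
  rfl

theorem trace_single_mul (n : ℕ) (l : List (LeavittGen V)) (w : FreeSemigroup (LeavittGen V))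
    (x : LeavittFree K V) :
    trace K n l (MonoidAlgebra.single w 1 * x) = trace K n (l ++ letters w) x := by
  suffices trace K n l ∘ₗ LinearMap.mulLeft K (MonoidAlgebra.single w 1) =
      trace K n (l ++ letters w) from LinearMap.congr_fun this x
  ext w'
  simp [MonoidAlgebra.single_mul_single, trace_single, letters_mul,
    wordTrace_append_comm K n (letters w)]

theorem trace_mul_single (n : ℕ) (l : List (LeavittGen V)) (w : FreeSemigroup (LeavittGen V))
    (x : LeavittFree K V) :
    trace K n l (x * MonoidAlgebra.single w 1) = trace K n (letters w ++ l) x := by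
  suffices trace K n l ∘ₗ LinearMap.mulRight K (MonoidAlgebra.single w 1) =
      trace K n (letters w ++ l) from LinearMap.congr_fun this x
  ext w'
  simp [MonoidAlgebra.single_mul_single, trace_single, letters_mul]

theorem trace_mul_comm (n : ℕ) (a b : LeavittFree K V) :
    trace K n [] (a * b) = trace K n [] (b * a) := by
  suffices (LinearMap.mul K (LeavittFree K V)).compr₂ (trace K n []) =
      (LinearMap.mul K (LeavittFree K V)).flip.compr₂ (trace K n []) from
    LinearMap.congr_fun₂ this a b
  ext w₁ w₂
  simp [MonoidAlgebra.single_mul_single, trace_single, letters_mul,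
    wordTrace_append_comm K n (letters w₁)]

theorem trace_eq_of_rel {n : ℕ} (hn : 0 < n) (l : List (LeavittGen V)) {x y : LeavittFree K V}
    (h : Rel K x y) : trace K n l x = trace K n l y := by
  cases h with
  | vertex_self v =>
    rw [trace_of_mul_of, trace_of]
    refine wordTrace_congr K n (by simp [wordDegree, LeavittGen.degree]) (fun z z' => ?_) l
    constructor
    · rintro ⟨_, ⟨rfl, -⟩, h⟩
      exact h
    · rintro ⟨_, ⟨rfl, h⟩, rfl⟩
      exact ⟨z, ⟨rfl, h⟩, z, ⟨rfl, h⟩, rfl⟩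
  | vertex_ne v w h =>
    rw [trace_of_mul_of, map_zero]
    refine wordTrace_eq_zero K n ?_ l
    rintro z z' ⟨_, ⟨rfl, hv⟩, _, ⟨rfl, hw⟩, rfl⟩
    exact h (hv.symm.trans hw)
  | source_edge e =>
    rw [trace_of_mul_of, trace_of]
    refine wordTrace_congr K n (by simp [wordDegree, LeavittGen.degree]) (fun z z' => ?_) l
    constructor
    · rintro ⟨_, ⟨rfl, -⟩, h⟩
      exact h
    · rintro ⟨y, hy, rfl⟩
      exact ⟨z, ⟨rfl, congrArg _ hy.1⟩, y, hy, rfl⟩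
  | edge_range e =>
    rw [trace_of_mul_of, trace_of]
    refine wordTrace_congr K n (by simp [wordDegree, LeavittGen.degree]) (fun z z' => ?_) l
    constructor
    · rintro ⟨y, hy, _, ⟨rfl, -⟩, rfl⟩
      exact ⟨y, hy, rfl⟩
    · rintro ⟨y, hy, rfl⟩
      exact ⟨y, hy, y, ⟨rfl, hy.right_eq.symm⟩, rfl⟩
  | range_ghost e =>
    rw [trace_of_mul_of, trace_of]
    refine wordTrace_congr K n (by simp [wordDegree, LeavittGen.degree]) (fun z z' => ?_) l
    constructor
    · rintro ⟨_, ⟨rfl, -⟩, h⟩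
      exact h
    · rintro ⟨y, hy, rfl⟩
      exact ⟨z, ⟨rfl, Extends.right_eq hy |>.symm⟩, y, hy, rfl⟩
  | ghost_source e =>
    rw [trace_of_mul_of, trace_of]
    refine wordTrace_congr K n (by simp [wordDegree, LeavittGen.degree]) (fun z z' => ?_) l
    constructor
    · rintro ⟨y, hy, _, ⟨rfl, -⟩, rfl⟩
      exact ⟨y, hy, rfl⟩
    · rintro ⟨y, hy, rfl⟩
      exact ⟨y, hy, y, ⟨rfl, congrArg _ hy.1⟩, rfl⟩
  | ck1_self e =>
    rw [trace_of_mul_of, trace_of]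
    exact wordTrace_congr K n (by simp [wordDegree, LeavittGen.degree]) (wordRel_ghost_edge e) l
  | ck1_ne e f h =>
    rw [trace_of_mul_of, map_zero]
    refine wordTrace_eq_zero K n ?_ l
    rintro z z' ⟨y, hy, y', hy', rfl⟩
    exact h (hy.1.symm.trans hy'.1)
  | ck2 v S hS hne =>
    simp only [map_sum, trace_of_mul_of, trace_of]
    exact wordTrace_vertex K hn v S hS l

/-- The trace property makes the elements killed by all `trace K n l` a two-sided ideal. -/
theorem trace_eq_zero_of_mem_relIdeal {n : ℕ} (hn : 0 < n) {x : LeavittFree K V}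
    (hx : x ∈ relIdeal K V) : trace K n [] x = 0 := by
  suffices relIdeal K V ≤ ⨅ l, LinearMap.ker (trace K n l) from
    (Submodule.mem_iInf _).1 (this hx) []
  refine relIdeal_le K (fun x y h => ?_) fun a x hx => ?_
  · simp [trace_eq_of_rel K hn _ h]
  · simp only [Submodule.mem_iInf, LinearMap.mem_ker] at hx ⊢
    have hleft (l : List (LeavittGen V)) :
        trace K n l ∘ₗ LinearMap.mulRight K x = 0 := by
      ext w
      simp [trace_single_mul, hx]
    have hright (l : List (LeavittGen V)) :
        trace K n l ∘ₗ LinearMap.mulLeft K x = 0 := by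
      ext w
      simp [trace_mul_single, hx]
    exact ⟨fun l => LinearMap.congr_fun (hleft l) a, fun l => LinearMap.congr_fun (hright l) a⟩

end LeavittFree

/-! ### The trace on the Leavitt path algebra -/

namespace LeavittPathAlgebra

open InfinitePath LeavittFree

variable (K : Type*) [Field K] {V : Type*} [Quiver V]

variable (V) in
/-- The trace functional of degree `n > 0` on the Leavitt path algebra. -/
noncomputable def trace {n : ℕ} (hn : 0 < n) : LeavittPathAlgebra K V →ₗ[K] K :=
  (relIdeal K V).liftQ (LeavittFree.trace K n []) fun _ hx =>
    trace_eq_zero_of_mem_relIdeal K hn hx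

theorem trace_mk {n : ℕ} (hn : 0 < n) (x : LeavittFree K V) :
    trace K V hn (mk K V x) = LeavittFree.trace K n [] x :=
  rfl

theorem trace_eq_zero_of_mem_commutatorSpan {n : ℕ} (hn : 0 < n) {x : LeavittPathAlgebra K V}
    (hx : x ∈ commutatorSpan (⊤ : Submodule K (LeavittPathAlgebra K V))) :
    trace K V hn x = 0 := by
  suffices commutatorSpan (⊤ : Submodule K (LeavittPathAlgebra K V)) ≤
      LinearMap.ker (trace K V hn) from this hx
  refine Submodule.span_le.2 ?_
  rintro _ ⟨a, -, b, -, rfl⟩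
  obtain ⟨a, rfl⟩ := mk_surjective a
  obtain ⟨b, rfl⟩ := mk_surjective b
  rw [SetLike.mem_coe, LinearMap.mem_ker, map_sub, ← mk_mul, ← mk_mul, trace_mk, trace_mk,
    trace_mul_comm, sub_self]

/-- A path `p` is represented by a word that removes from every infinite path starting with `p` this
initial segment; here `p` is recorded by the sequences `f` of its edges and `g` of its vertices. -/
theorem exists_word_ofPath [Nonempty (Quiver.Total V)] {v w : V} (p : Quiver.Path v w) :
    ∃ (u : FreeSemigroup (LeavittGen V)) (f : ℕ → Quiver.Total V) (g : ℕ → V),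
      ofPath K p = mk K V (MonoidAlgebra.single u 1) ∧ wordDegree (letters u) = p.length ∧
      g 0 = v ∧ g p.length = w ∧
      (∀ i < p.length, (f i).left = g i ∧ (f i).right = g (i + 1)) ∧
      ∀ z : InfinitePath V, (z.edge 0).left = v → (∀ i < p.length, z.edge i = f i) →
        WordRel (letters u) z (z.drop p.length) := by
  induction p with
  | nil =>
    refine ⟨FreeSemigroup.of (.vertex v), fun _ => Classical.arbitrary _, fun _ => v, rfl, rfl, rfl,
      rfl, fun i hi => absurd hi (Nat.not_lt_zero i), fun z hz _ => ?_⟩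
    refine (wordRel_vertex v _ _).2 ⟨?_, hz⟩
    ext1
    funext i
    exact congrArg z.edge (zero_add i).symm
  | @cons b c p e ih =>
    obtain ⟨u, f, g, hu, hd, hg0, hgl, hfg, h⟩ := ih
    refine ⟨u * FreeSemigroup.of (.edge ⟨_, _, e⟩),
      fun i => if i < p.length then f i else ⟨_, _, e⟩,
      fun i => if i ≤ p.length then g i else c, ?_, ?_, by simpa using hg0, by simp, ?_, ?_⟩
    · rw [ofPath, hu, edge, of, ← mk_mul, MonoidAlgebra.single_mul_single, one_mul]
    · rw [letters_mul, wordDegree_append, hd]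
      rfl
    · intro i hi
      rw [Quiver.Path.length_cons] at hi
      rcases Nat.lt_succ_iff_lt_or_eq.1 hi with hi | rfl
      · simpa [hi, hi.le] using hfg i hi
      · simp [hgl]
    · intro z hz hzf
      rw [letters_mul, wordRel_append]
      refine ⟨_, h z hz fun i hi => ?_, _, ⟨?_, fun i => ?_⟩, rfl⟩
      · simpa [hi] using hzf i (hi.trans (Nat.lt_succ_self _))
      · exact (hzf p.length (Nat.lt_succ_self _)).trans (if_neg (lt_irrefl _))
      · exact congrArg z.edge (by simp only [Quiver.Path.length_cons]; ring)

theorem exists_word_star_ofPath {v w : V} (p : Quiver.Path v w) :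
    ∃ u : FreeSemigroup (LeavittGen V),
      star (ofPath K p) = mk K V (MonoidAlgebra.single u 1) ∧
        wordDegree (letters u) = -p.length := by
  induction p with
  | nil => exact ⟨FreeSemigroup.of (.vertex v), star_vertex K v, rfl⟩
  | cons p e ih =>
    obtain ⟨u, hu, hd⟩ := ih
    refine ⟨FreeSemigroup.of (.ghost ⟨_, _, e⟩) * u, ?_, ?_⟩
    · rw [ofPath, star_mul, hu, star_edge, ghost, of, ← mk_mul, MonoidAlgebra.single_mul_single,
        one_mul]
    · rw [letters_mul, wordDegree_append, hd]
      simp [letters_of, wordDegree, LeavittGen.degree]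

/-- The infinite path `c c c ⋯` is a fixed point of a closed path `c`. -/
theorem trace_ofPath {v : V} (c : Quiver.Path v v) (hc : 0 < c.length) :
    trace K V hc (ofPath K c) = 1 := by
  have : Nonempty (Quiver.Total V) := by
    cases c with
    | nil => exact absurd hc (lt_irrefl _)
    | cons p e => exact ⟨⟨_, _, e⟩⟩
  obtain ⟨u, f, g, hu, hd, hg0, hgl, hfg, h⟩ := exists_word_ofPath K c
  have hmod (i : ℕ) := hfg (i % c.length) (Nat.mod_lt i hc)
  let z : InfinitePath V :=
    { edge i := f (i % c.length)
      right_eq_left i := by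
        rw [(hmod i).2, (hmod (i + 1)).1, ← Nat.mod_add_mod]
        rcases (Nat.succ_le_of_lt (Nat.mod_lt i hc)).lt_or_eq with hi | hi
        · rw [Nat.mod_eq_of_lt hi]
        · rw [Nat.succ_eq_add_one] at hi
          rw [hi, Nat.mod_self, hg0, hgl] }
  have hz : z.drop c.length = z := by
    ext1
    funext i
    exact congrArg f (Nat.add_mod_left _ _)
  have hrel := h z (by rw [(hmod 0).1, Nat.zero_mod, hg0])
    fun i hi => congrArg f (Nat.mod_eq_of_lt hi)
  rw [hz] at hrel
  rw [hu, trace_mk, trace_single, List.append_nil]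
  exact if_pos ⟨hd, z, hrel⟩

theorem trace_star_ofPath {v : V} (c : Quiver.Path v v) (hc : 0 < c.length) :
    trace K V hc (star (ofPath K c)) = 0 := by
  obtain ⟨u, hu, hd⟩ := exists_word_star_ofPath K c
  rw [hu, trace_mk, trace_single, List.append_nil]
  exact if_neg fun h => by omega

theorem ofPath_sub_star_notMem_commutatorSpan {v : V} (c : Quiver.Path v v) (hc : 0 < c.length) :
    ofPath K c - star (ofPath K c) ∉
      commutatorSpan (⊤ : Submodule K (LeavittPathAlgebra K V)) := fun h => by
  have h0 := trace_eq_zero_of_mem_commutatorSpan K hc h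
  rw [map_sub, trace_ofPath, trace_star_ofPath, sub_zero] at h0
  exact one_ne_zero h0

theorem sub_star_mem_skewSymmetric (x : LeavittPathAlgebra K V) :
    x - star x ∈ skewSymmetric K V := by
  change star (x - star x) = -(x - star x)
  rw [star_sub, star_star, neg_sub]

end LeavittPathAlgebra

theorem commutatorSpan_mono {K : Type*} [Field K] {A : Type*} [NonUnitalRing A] [Module K A]
    {I J : Submodule K A} (h : I ≤ J) : commutatorSpan I ≤ commutatorSpan J :=
  Submodule.span_mono fun _ ⟨a, ha, b, hb, hz⟩ => ⟨a, h ha, b, h hb, hz⟩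

theorem corollary3p8 (K : Type*) [Field K] (V : Type*) [Quiver V]
    (hE : ∃ (v : V) (c : Quiver.Path v v), c.IsCycleAt) :
    LeavittPathAlgebra.skewSymmetric K V ≠
        commutatorSpan (LeavittPathAlgebra.skewSymmetric K V) ∧
      ∀ (v : V) (c : Quiver.Path v v), c.IsCycleAt →
        LeavittPathAlgebra.ofPath K c - star (LeavittPathAlgebra.ofPath K c) ∈
            LeavittPathAlgebra.skewSymmetric K V ∧
          LeavittPathAlgebra.ofPath K c - star (LeavittPathAlgebra.ofPath K c) ∉
            commutatorSpan (⊤ : Submodule K (LeavittPathAlgebra K V)) := by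
  have hmem (v : V) (c : Quiver.Path v v) :=
    LeavittPathAlgebra.sub_star_mem_skewSymmetric K (LeavittPathAlgebra.ofPath K c)
  refine ⟨fun heq => ?_, fun v c hc =>
    ⟨hmem v c, LeavittPathAlgebra.ofPath_sub_star_notMem_commutatorSpan K c hc.1⟩⟩
  obtain ⟨v, c, hc⟩ := hE
  exact LeavittPathAlgebra.ofPath_sub_star_notMem_commutatorSpan K c hc.1
    (commutatorSpan_mono le_top (heq ▸ hmem v c))
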